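/- Let $A\in\mathbb{R}^{d\times d}$ be symmetric, $b\in\mathbb{R}^d$, $\rho\ge 0$, and put $f(x)=\tfrac12 x^{T}Ax+b^{T}x$ and $f_\rho(x)=f(x)+\tfrac{\rho}{3}\|x\|^3$, where $\|\cdot\|$ is the Euclidean norm. Let $\lambda_{\min},\lambda_{\max}$ be the smallest and largest eigenvalues of $A$. Let $s^\star$ be a global minimizer of $f_\rho$ over $\mathbb{R}^d$, and for an integer $t>0$ let $s_t$ be a minimizer of $f_\rho$ over the Krylov subspace $\mathcal{K}_t(A,b)=\mathrm{span}\{b,Ab,\dots,A^{t-1}b\}$. Then: 1. (Linear rate) $$f_\rho(s_t)-f_\rho(s^\star)\le 36\,\bigl[f_\rho(0)-f_\rho(s^\star)\bigr]\exp\left\{-4t\sqrt{\frac{\lambda_{\min}+\rho\|s^\star\|}{\lambda_{\max}+\rho\|s^\star\|}}\right\},$$ where the quotient is read as $0$ if $\lambda_{\max}+\rho\|s^\star\|=0$. 2. (Sublinear rate) For every unit eigenvector $u_{\min}$ of $A$ with eigenvalue $\lambda_{\min}$, $$f_\rho(s_t)-f_\rho(s^\star)\le \frac{(\lambda_{\max}-\lambda_{\min})\|s^\star\|^2}{(t-\frac12)^2}\left[4+\frac{\mathbb{1}_{\{\lambda_{\min}<0\}}}{8}\log^2\left(\frac{4\|b\|^2}{(u_{\min}^{T}b)^2}\right)\right],$$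 provided that $u_{\min}^{T}b\ne 0$ in case $\lambda_{\min}<0$ (otherwise the right-hand side is read as $+\infty$ and nothing is claimed); if $\lambda_{\min}\ge 0$, the logarithmic term is absent. 3. (Comparison with the trust-region problem) If $r$ minimizes $f$ over $\{x:\|x\|\le\|s^\star\|\}$ and $r_t$ minimizes $f$ over $\{x\in\mathcal{K}_t(A,b):\|x\|\le\|s^\star\|\}$, then $$f_\rho(s_t)-f_\rho(s^\star)\le f(r_t)-f(r).$$ -/

import Mathlib

namespace KrylovCubic

noncomputable section

/-- The quadratic `½ xᵀ A x + bᵀ x` on Euclidean space `ℝᵈ`. -/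
def quad {d : ℕ} (A : Matrix (Fin d) (Fin d) ℝ) (b x : EuclideanSpace ℝ (Fin d)) : ℝ :=
  1 / 2 * inner ℝ x (Matrix.toEuclideanLin A x) + inner ℝ b x

/-- The cubic-regularized objective `½ xᵀ A x + bᵀ x + (ρ/3) ‖x‖³`. -/
def cubic {d : ℕ} (A : Matrix (Fin d) (Fin d) ℝ) (b : EuclideanSpace ℝ (Fin d)) (ρ : ℝ)
    (x : EuclideanSpace ℝ (Fin d)) : ℝ :=
  quad A b x + ρ / 3 * ‖x‖ ^ 3

/-- The Krylov subspace `span {b, A b, …, A^(t-1) b}` of order `t`. -/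
def krylov {d : ℕ} (A : Matrix (Fin d) (Fin d) ℝ) (b : EuclideanSpace ℝ (Fin d)) (t : ℕ) :
    Submodule ℝ (EuclideanSpace ℝ (Fin d)) :=
  Submodule.span ℝ (Set.range fun k : Fin t => Matrix.toEuclideanLin (A ^ (k : ℕ)) b)

/-- The smallest eigenvalue of a real symmetric matrix (of size at least one). -/
def lambdaMin {d : ℕ} (A : Matrix (Fin d) (Fin d) ℝ) : ℝ := sInf (spectrum ℝ A)

/-- The largest eigenvalue of a real symmetric matrix (of size at least one). -/
def lambdaMax {d : ℕ} (A : Matrix (Fin d) (Fin d) ℝ) : ℝ := sSup (spectrum ℝ A)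

/-- `s` is a global minimizer of `f` over the set `S`. -/
def IsMinimizer {E : Type*} (f : E → ℝ) (S : Set E) (s : E) : Prop :=
  s ∈ S ∧ ∀ x ∈ S, f s ≤ f x

end

end KrylovCubic

/-! ### Chebyshev estimates and the polynomial behind the linear rate. -/

namespace KrylovCubic

open Polynomial Polynomial.Chebyshev

/-! Put `μ = ρ‖s‖`. A global minimizer satisfies `(A + μ)s = -b` and `A + μ ⪰ 0`, and the gap is
then exact (`cubic_sub_cubic`): `½ (x-s)ᵀ(A+μ)(x-s)` plus a term that vanishes when `‖x‖ = ‖s‖`. If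
`q(0) = 1` and `deg q ≤ t`, the vector `s - q(A+μ)s` lies in the Krylov space
(`exists_mem_krylov_of_poly`). Each rate thus comes from a test vector in that space, built from a
polynomial that is small on the spectrum of `A + μ`.

Linear rate: `q` is a rescaled Chebyshev polynomial with `|q| ≤ ε`. Rescaling the vector to norm
`‖s‖` removes the cubic remainder and turns `ε` into `3ε`; with `ε = 2 exp(-2tw)`, where `w` is the
square root in the exponent, the factor is `9ε² = 36 exp(-4tw)`.

Sublinear rate: `q` is of Fejér type (`exists_poly_sublinear_rate`), so `0 ≤ q ≤ 1` and the test
vector `y` is no longer than `s`. If `λ_min ≥ 0`, the cubic remainder of `y` is absorbed by `λ_min +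
μ ≥ μ`. If `λ_min < 0`, a multiple of a Krylov vector with Rayleigh quotient near `λ_min` is added
to reach norm `‖s‖`; that vector (`exists_mem_krylov_ritz`) is the source of the logarithm.

The trust-region comparison only tests `s_t` against `r_t`, and `r` against `s`. -/

lemma tanh_le_self {x : ℝ} (hx : 0 ≤ x) : Real.tanh x ≤ x := by
  have hmono : MonotoneOn (fun y : ℝ => y * Real.cosh y - Real.sinh y) (Set.Ici 0) := by
    refine monotoneOn_of_deriv_nonneg (convex_Ici 0) (by fun_prop) (by fun_prop) ?_
    intro y hy
    rw [interior_Ici] at hy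
    have h : HasDerivAt (fun y : ℝ => y * Real.cosh y - Real.sinh y)
        (1 * Real.cosh y + y * Real.sinh y - Real.cosh y) y :=
      ((hasDerivAt_id y).mul (Real.hasDerivAt_cosh y)).sub (Real.hasDerivAt_sinh y)
    rw [h.deriv]
    have := Real.sinh_pos_iff.2 hy
    have : 0 < y * Real.sinh y := mul_pos hy this
    linarith
  have h := hmono (Set.mem_Ici.2 le_rfl) (Set.mem_Ici.2 hx) hx
  simp only [Real.sinh_zero, zero_mul, sub_zero] at h
  rw [Real.tanh_eq_sinh_div_cosh, div_le_iff₀ (Real.cosh_pos x)]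
  linarith

lemma cosh_eq_one_add_two_mul_sinh_sq (x : ℝ) : Real.cosh x = 1 + 2 * Real.sinh (x / 2) ^ 2 := by
  have h := Real.cosh_two_mul (x / 2)
  have h' := Real.cosh_sq (x / 2)
  rw [mul_div_cancel₀ x two_ne_zero] at h
  linarith

lemma cos_eq_one_sub_two_mul_sin_sq (x : ℝ) : Real.cos x = 1 - 2 * Real.sin (x / 2) ^ 2 := by
  have h := Real.cos_two_mul (x / 2)
  have h' := Real.cos_sq' (x / 2)
  rw [mul_div_cancel₀ x two_ne_zero] at h
  linarith

lemma abs_sin_nat_mul_le (n : ℕ) (x : ℝ) : |Real.sin (n * x)| ≤ n * |Real.sin x| := by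
  induction n with
  | zero => simp
  | succ n ih =>
    have h : Real.sin ((n + 1 : ℕ) * x)
        = Real.sin (n * x) * Real.cos x + Real.cos (n * x) * Real.sin x := by
      push_cast
      rw [add_mul, one_mul, Real.sin_add]
    rw [h]
    refine (abs_add_le _ _).trans ?_
    rw [abs_mul, abs_mul]
    have h1 := mul_le_of_le_one_right (abs_nonneg (Real.sin (n * x))) (Real.abs_cos_le_one x)
    have h2 := mul_le_of_le_one_left (abs_nonneg (Real.sin x)) (Real.abs_cos_le_one (n * x))
    push_cast
    linarith

/-- On `[-1, 1]` the Chebyshev polynomial `T_n` stays above its tangent line at `1`. -/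
lemma one_sub_eval_T_le (n : ℕ) {c : ℝ} (h1 : -1 ≤ c) (h2 : c ≤ 1) :
    1 - (T ℝ n).eval c ≤ (n : ℝ) ^ 2 * (1 - c) := by
  obtain ⟨φ, rfl⟩ : ∃ φ, Real.cos φ = c := ⟨_, Real.cos_arccos h1 h2⟩
  rw [T_real_cos, cos_eq_one_sub_two_mul_sin_sq φ, cos_eq_one_sub_two_mul_sin_sq (_ * φ)]
  have h := abs_sin_nat_mul_le n (φ / 2)
  have h3 := pow_le_pow_left₀ (abs_nonneg _) h 2
  rw [mul_pow, sq_abs, sq_abs] at h3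
  push_cast
  rw [mul_div_assoc]
  linarith

/-- The third order Taylor polynomial of `T_n` at `1` bounds `T_n` from below on `[1, ∞)`. -/
lemma taylor_le_eval_T (n : ℕ) {x : ℝ} (hx : 0 ≤ x) :
    1 + (n : ℝ) ^ 2 * x + (n : ℝ) ^ 2 * ((n : ℝ) ^ 2 - 1) / 6 * x ^ 2
      + (n : ℝ) ^ 2 * ((n : ℝ) ^ 2 - 1) * ((n : ℝ) ^ 2 - 4) / 90 * x ^ 3
      ≤ (T ℝ n).eval (1 + x) := by
  let P : ℝ → ℝ := fun n => 1 + n ^ 2 * x + n ^ 2 * (n ^ 2 - 1) / 6 * x ^ 2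
      + n ^ 2 * (n ^ 2 - 1) * (n ^ 2 - 4) / 90 * x ^ 3
  suffices h : P n ≤ (T ℝ n).eval (1 + x) ∧
      P (n + 1) - P n ≤ (T ℝ (n + 1 : ℤ)).eval (1 + x) - (T ℝ n).eval (1 + x) from h.1
  induction n with
  | zero => constructor <;> simp [P]
  | succ n ih =>
    obtain ⟨ih1, ih2⟩ := ih
    have hT : (T ℝ ((n : ℤ) + 2)).eval (1 + x)
        = 2 * (1 + x) * (T ℝ ((n : ℤ) + 1)).eval (1 + x) - (T ℝ n).eval (1 + x) := by
      rw [T_add_two]; simp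
    have h1 : P (n + 1) ≤ (T ℝ ((n : ℤ) + 1)).eval (1 + x) := by linarith
    have hc : 0 ≤ ((n : ℝ) + 1) ^ 2 * (((n : ℝ) + 1) ^ 2 - 1) * (((n : ℝ) + 1) ^ 2 - 4) := by
      rcases n with _ | n
      · simp
      · have : (0 : ℝ) ≤ n := n.cast_nonneg
        push_cast
        have h3 : 0 ≤ ((n : ℝ) + 1 + 1) ^ 2 - 1 := by nlinarith
        have h4 : 0 ≤ ((n : ℝ) + 1 + 1) ^ 2 - 4 := by nlinarith
        positivity
    push_cast
    refine ⟨h1, ?_⟩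
    rw [show (n : ℤ) + 1 + 1 = n + 2 by ring, hT]
    have h2 : P (n + 1 + 1) - P (n + 1) = P (n + 1) - P n + 2 * x * P (n + 1)
        - 2 * x ^ 4 * (((n : ℝ) + 1) ^ 2 * (((n : ℝ) + 1) ^ 2 - 1) *
          (((n : ℝ) + 1) ^ 2 - 4)) / 90 := by
      simp only [P]; ring
    have h3 := mul_le_mul_of_nonneg_left h1 (by positivity : 0 ≤ 2 * x)
    have h4 := mul_nonneg (by positivity : 0 ≤ 2 * x ^ 4) hc
    linarith

/-- `T_n(cosh ψ)` grows exponentially. -/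
lemma exp_le_eval_T_cosh (n : ℕ) (ψ : ℝ) :
    Real.exp (n * ψ) / 2 ≤ (T ℝ n).eval (Real.cosh ψ) := by
  rw [T_real_cosh, Real.cosh_eq]
  push_cast
  have := Real.exp_pos (-(n * ψ))
  linarith

lemma natDegree_comp_linear_le (p : ℝ[X]) (a b : ℝ) :
    (p.comp (Polynomial.C a * X + Polynomial.C b)).natDegree ≤ p.natDegree :=
  natDegree_comp_le.trans ((Nat.mul_le_mul_left _ natDegree_linear_le).trans (mul_one _).le)

/-- A polynomial of degree at most `t` with value `1` at `0` that is uniformly small on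
`[θ, θ + D]`. -/
lemma exists_poly_linear_rate {t : ℕ} (ht : 0 < t) {θ D : ℝ} (hθ : 0 < θ) (hD : 0 ≤ D) :
    ∃ q : ℝ[X], q.natDegree ≤ t ∧ q.eval 0 = 1 ∧ ∀ x ∈ Set.Icc θ (θ + D),
      |q.eval x| ≤ 2 * Real.exp (-2 * t * Real.sqrt (θ / (θ + D))) := by
  -- For `D = 0` the interval is the point `θ`, and `1 - x/θ` vanishes there.
  rcases hD.eq_or_lt with rfl | hD
  · refine ⟨1 - Polynomial.C θ⁻¹ * X, ?_, by simp, ?_⟩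
    · refine (natDegree_sub_le _ _).trans (max_le (by simp) ?_)
      exact (natDegree_C_mul_le _ _).trans (natDegree_X_le.trans ht)
    · rintro x ⟨h1, h2⟩
      obtain rfl : x = θ := le_antisymm (by simpa using h2) h1
      simp [hθ.ne', (Real.exp_pos _).le]
  -- The affine map sending `[θ, θ + D]` onto `[-1, 1]` with reversed orientation sends `0` to `1 +
  -- 2θ/D = cosh ψ`.
  · set ψ := 2 * Real.arsinh (Real.sqrt (θ / D)) with hψ
    have hψ0 : 0 ≤ Real.arsinh (Real.sqrt (θ / D)) := Real.arsinh_nonneg_iff.2 (Real.sqrt_nonneg _)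
    have hcosh : Real.cosh ψ = 1 + 2 * θ / D := by
      rw [cosh_eq_one_add_two_mul_sinh_sq, hψ, mul_div_cancel_left₀ _ two_ne_zero,
        Real.sinh_arsinh, Real.sq_sqrt (by positivity)]
      ring
    have hrate : Real.sqrt (θ / (θ + D)) ≤ ψ / 2 := by
      have h := tanh_le_self hψ0
      rw [Real.tanh_arsinh, Real.sq_sqrt (by positivity), ← Real.sqrt_div (by positivity)] at h
      rw [hψ, mul_div_cancel_left₀ _ two_ne_zero]
      convert h using 2
      field_simp
      ring
    set M := (T ℝ t).eval (Real.cosh ψ) with hM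
    have hMlow := exp_le_eval_T_cosh t ψ
    have hMpos : 0 < M := lt_of_lt_of_le (by positivity) hMlow
    refine ⟨Polynomial.C M⁻¹ * (T ℝ t).comp
      (Polynomial.C (-2 / D) * X + Polynomial.C (1 + 2 * θ / D)), ?_, ?_, ?_⟩
    · refine (natDegree_C_mul_le _ _).trans ((natDegree_comp_linear_le _ _ _).trans ?_)
      rw [natDegree_T, Int.natAbs_natCast]
    · simp only [eval_mul, eval_C, eval_comp, eval_add, eval_X, mul_zero, zero_add]
      rw [← hcosh, ← hM, inv_mul_cancel₀ hMpos.ne']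
    · rintro x ⟨h1, h2⟩
      simp only [eval_mul, eval_C, eval_comp, eval_add, eval_X]
      have hc : |-2 / D * x + (1 + 2 * θ / D)| ≤ 1 := by
        have : -2 / D * x + (1 + 2 * θ / D) = 1 - 2 * ((x - θ) / D) := by ring
        rw [this]
        have h3 : 0 ≤ (x - θ) / D := div_nonneg (by linarith) hD.le
        have h4 : (x - θ) / D ≤ 1 := (div_le_one hD).2 (by linarith)
        rw [abs_le]; constructor <;> linarith
      have hT := abs_eval_T_real_le_one t hc
      rw [abs_mul, abs_of_pos (inv_pos.2 hMpos)]
      calc M⁻¹ * _ ≤ M⁻¹ * 1 := by gcongr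
        _ ≤ (Real.exp (t * ψ) / 2)⁻¹ := by
            rw [mul_one]; exact inv_anti₀ (by positivity) hMlow
        _ = 2 * Real.exp (-(t * ψ)) := by rw [Real.exp_neg]; field_simp
        _ ≤ _ := by
            have : (t : ℝ) * Real.sqrt (θ / (θ + D)) ≤ t * (ψ / 2) := by gcongr
            gcongr
            linarith

end KrylovCubic

/-! ### Polynomials for the sublinear rate: Fejér type and Ritz type. -/

namespace KrylovCubic

open Polynomial Polynomial.Chebyshev

/-- The right side is the Taylor lower bound for the Fejér normalization, with `y = θ/D`. For `t ≤
2` its linear term suffices; for `t ≥ 2` a square is completed. -/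
lemma mul_le_one_add_quadratic {t y : ℝ} (ht : 1 ≤ t) (hy : 0 ≤ y) :
    2 * t ^ 2 / 3 * y ≤ 1 + t * (t + 2) / 3 * y
      + 2 * (t * (t + 2) * (t - 1) * (t + 3)) / 45 * y ^ 2 := by
  have hb : 0 ≤ 2 * (t * (t + 2) * (t - 1) * (t + 3)) / 45 := by
    have : 0 ≤ t - 1 := by linarith
    positivity
  rcases le_total t 2 with h | h
  · have h1 : 0 ≤ t * (2 - t) / 3 * y := by
      have : 0 ≤ 2 - t := by linarith
      positivity
    have h2 := mul_nonneg hb (sq_nonneg y)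
    nlinarith
  · have h1 : 0 ≤ 2 * (t * (t + 2) * (t - 1) * (t + 3)) / 45 - (t * (t - 2) / 6) ^ 2 := by
      obtain ⟨k, rfl⟩ : ∃ k, t = k + 2 := ⟨t - 2, by ring⟩
      have hk : 0 ≤ k := by linarith
      ring_nf
      positivity
    have h2 := mul_nonneg h1 (sq_nonneg y)
    nlinarith [sq_nonneg (1 - t * (t - 2) / 6 * y)]

/-- A nonnegative polynomial of degree at most `t` with value `1` at `0`, obtained from
the Fejér kernel, adapted to the interval `[θ, θ + D]`. -/
lemma exists_poly_sublinear_rate {t : ℕ} (ht : 0 < t) {θ D : ℝ} (hθ : 0 ≤ θ) (hD : 0 < D) :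
    ∃ (q : ℝ[X]) (δ : ℝ), q.natDegree ≤ t ∧ q.eval 0 = 1 ∧ δ ≤ 1 ∧
      2 * (θ * δ) + D / ((t : ℝ) + 1) ^ 2 ≤ 4 * D / ((t : ℝ) - 1 / 2) ^ 2 ∧
      ∀ x ∈ Set.Icc θ (θ + D), 0 ≤ q.eval x ∧ q.eval x ≤ δ ∧
        (x - θ) * q.eval x ^ 2 ≤ D / ((t : ℝ) + 1) ^ 2 := by
  have ht1 : (1 : ℝ) ≤ t := by exact_mod_cast ht
  -- Degree `t + 1` is allowed because `G` vanishes at `0` and one factor `X` is divided out. In `G`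
  -- the variable is the offset `e = x - θ`, so the normalization point `x = 0` becomes `e = -θ`.
  set G : ℝ[X] := 1 - (T ℝ (t + 1 : ℕ)).comp (Polynomial.C (-2 / D) * X + Polynomial.C 1) with hG
  set H : ℝ[X] := divX G with hH
  have hGe : ∀ e : ℝ, G.eval e = 1 - (T ℝ (t + 1 : ℕ)).eval (1 - 2 * (e / D)) := by
    intro e
    simp only [hG, eval_sub, eval_one, eval_comp, eval_add, eval_mul, eval_C, eval_X]
    congr 2
    ring
  have hGH : ∀ e : ℝ, G.eval e = e * H.eval e := by
    intro e
    have h0 : G.coeff 0 = 0 := by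
      rw [coeff_zero_eq_eval_zero, hGe]; simp
    conv_lhs => rw [← divX_mul_X_add G, h0]
    simp [hH, mul_comm]
  have hdeg : H.natDegree ≤ t := by
    rw [hH, natDegree_divX_eq_natDegree_tsub_one]
    have : G.natDegree ≤ t + 1 := by
      refine (natDegree_sub_le _ _).trans (max_le (by simp) ((natDegree_comp_linear_le _ _ _).trans ?_))
      rw [natDegree_T, Int.natAbs_natCast]
    omega
  set h₀ : ℝ := 2 * ((t : ℝ) + 1) ^ 2 / D with hh₀
  have hh₀pos : 0 < h₀ := by positivity
  have hH0 : H.eval 0 = h₀ := by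
    have h1 : H.eval 0 = (derivative G).eval 0 := by
      rw [← coeff_zero_eq_eval_zero, ← coeff_zero_eq_eval_zero, coeff_derivative, hH, coeff_divX]
      simp
    rw [h1, hG]
    simp only [derivative_sub, derivative_one, derivative_comp, T_derivative_eq_U, zero_sub,
      derivative_add, derivative_mul, derivative_C, derivative_X, eval_neg, eval_mul, eval_comp,
      eval_add, eval_C, eval_X, eval_zero, eval_one, eval_intCast]
    rw [hh₀]
    simp
    field_simp
  have hHbound : ∀ e ∈ Set.Icc 0 D, 0 ≤ H.eval e ∧ H.eval e ≤ h₀ ∧ e * H.eval e ^ 2 ≤ 2 * h₀ := by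
    rintro e ⟨he0, heD⟩
    have hc1 : -1 ≤ 1 - 2 * (e / D) := by
      have := (div_le_one hD).2 heD
      linarith
    have hc2 : 1 - 2 * (e / D) ≤ 1 := by
      have := div_nonneg he0 hD.le
      linarith
    have hT := eval_T_real_mem_Icc (t + 1 : ℕ) (x := 1 - 2 * (e / D)) ⟨hc1, hc2⟩
    have hlin := one_sub_eval_T_le (t + 1) hc1 hc2
    rw [← hGe, hGH] at hlin
    have hG2 : e * H.eval e ≤ 2 := by
      rw [← hGH, hGe]; linarith [hT.1]
    have hG0 : 0 ≤ e * H.eval e := by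
      rw [← hGH, hGe]; linarith [hT.2]
    have hb : 0 ≤ H.eval e ∧ H.eval e ≤ h₀ := by
      rcases he0.eq_or_lt with rfl | he
      · rw [hH0]; exact ⟨hh₀pos.le, le_rfl⟩
      · refine ⟨nonneg_of_mul_nonneg_right hG0 he, ?_⟩
        refine le_of_mul_le_mul_left (hlin.trans (le_of_eq ?_)) he
        rw [hh₀]; push_cast; ring
    refine ⟨hb.1, hb.2, ?_⟩
    calc e * H.eval e ^ 2 = (e * H.eval e) * H.eval e := by ring
      _ ≤ 2 * h₀ := mul_le_mul hG2 hb.2 hb.1 (by norm_num)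
  set K := H.eval (-θ) with hK
  have hKlow : h₀ * (1 + (t : ℝ) * (t + 2) / 3 * (θ / D)
      + 2 * ((t : ℝ) * (t + 2) * (t - 1) * (t + 3)) / 45 * (θ / D) ^ 2) ≤ K := by
    rcases hθ.eq_or_lt with rfl | hθ
    · simp [hK, hH0]
    · have h1 := taylor_le_eval_T (t + 1) (x := 2 * (θ / D)) (by positivity)
      have h2 := hGe (-θ)
      rw [hGH, show 1 - 2 * (-θ / D) = 1 + 2 * (θ / D) by ring] at h2
      refine le_of_mul_le_mul_left ?_ hθ
      have h3 : θ * K = (T ℝ (t + 1 : ℕ)).eval (1 + 2 * (θ / D)) - 1 := by rw [hK]; linarith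
      rw [h3]
      refine le_trans (le_of_eq ?_) (sub_le_sub_right h1 1)
      rw [hh₀]
      push_cast
      field_simp
      ring
  have hy : 0 ≤ θ / D := by positivity
  have ht0 : (0 : ℝ) ≤ (t : ℝ) - 1 := by linarith
  have hK0 : h₀ ≤ K := by
    refine le_trans (le_mul_of_one_le_right hh₀pos.le ?_) hKlow
    have h1 : 0 ≤ (t : ℝ) * (t + 2) / 3 * (θ / D) := by positivity
    have h2 : 0 ≤ 2 * ((t : ℝ) * (t + 2) * (t - 1) * (t + 3)) / 45 * (θ / D) ^ 2 := by positivity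
    linarith
  have hKpos : 0 < K := hh₀pos.trans_le hK0
  have hKm : h₀ * (2 * (t : ℝ) ^ 2 / 3 * (θ / D)) ≤ K :=
    le_trans (mul_le_mul_of_nonneg_left (mul_le_one_add_quadratic ht1 hy) hh₀pos.le) hKlow
  refine ⟨Polynomial.C K⁻¹ * H.comp (X - Polynomial.C θ), h₀ / K, ?_, ?_, ?_, ?_, ?_⟩
  · refine (natDegree_C_mul_le _ _).trans (natDegree_comp_le.trans ?_)
    rw [natDegree_X_sub_C, mul_one]; exact hdeg
  · simp only [eval_mul, eval_C, eval_comp, eval_sub, eval_X, zero_sub]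
    rw [← hK, inv_mul_cancel₀ hKpos.ne']
  · exact (div_le_one hKpos).2 hK0
  -- Of the constant `4`, the term `2θδ` uses three units and `D/(t+1)²` the fourth.
  · have h1 : θ * (h₀ / K) ≤ 3 * D / (2 * (t : ℝ) ^ 2) := by
      rw [le_div_iff₀ (by positivity), mul_assoc, div_mul_eq_mul_div, mul_div_assoc', div_le_iff₀ hKpos]
      calc θ * (h₀ * (2 * (t : ℝ) ^ 2)) = 3 * D * (h₀ * (2 * (t : ℝ) ^ 2 / 3 * (θ / D))) := by
            field_simp
        _ ≤ 3 * D * K := by gcongr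
    have h2 : 3 * D / (t : ℝ) ^ 2 ≤ 3 * D / ((t : ℝ) - 1 / 2) ^ 2 := by
      have : (0 : ℝ) < t - 1 / 2 := by linarith
      gcongr
      linarith
    have h3 : D / ((t : ℝ) + 1) ^ 2 ≤ D / ((t : ℝ) - 1 / 2) ^ 2 := by
      have : (0 : ℝ) < t - 1 / 2 := by linarith
      gcongr
      linarith
    have h4 : 2 * (3 * D / (2 * (t : ℝ) ^ 2)) = 3 * D / (t : ℝ) ^ 2 := by field_simp
    have h5 : 4 * D / ((t : ℝ) - 1 / 2) ^ 2
        = 3 * D / ((t : ℝ) - 1 / 2) ^ 2 + D / ((t : ℝ) - 1 / 2) ^ 2 := by ring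
    linarith
  · rintro x ⟨hx1, hx2⟩
    obtain ⟨b1, b2, b3⟩ := hHbound (x - θ) ⟨by linarith, by linarith⟩
    simp only [eval_mul, eval_C, eval_comp, eval_sub, eval_X]
    refine ⟨by positivity, ?_, ?_⟩
    · rw [div_eq_inv_mul]; gcongr
    · calc (x - θ) * (K⁻¹ * H.eval (x - θ)) ^ 2
          = ((x - θ) * H.eval (x - θ) ^ 2) / K ^ 2 := by field_simp
        _ ≤ (2 * h₀) / h₀ ^ 2 := by gcongr
        _ = D / ((t : ℝ) + 1) ^ 2 := by rw [hh₀]; field_simp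

lemma U_sq_add_U_sq (n : ℤ) :
    U ℝ n ^ 2 + U ℝ (n - 1) ^ 2 - 2 * X * U ℝ (n - 1) * U ℝ n = 1 := by
  have h := congrArg (fun p : ℝ[X] => p.comp (2 * X)) (S_sq_add_S_sq ℝ (n - 1))
  simp only [sub_comp, add_comp, pow_comp, mul_comp, S_comp_two_mul_X, X_comp, one_comp,
    sub_add_cancel] at h
  rw [add_comm (U ℝ n ^ 2)]
  exact h

/-- At `X = cos φ` the sum is `sin((n+½)φ) / sin(φ/2)`, while `1 - X = 2 sin²(φ/2)`. -/
lemma one_sub_X_mul_sq_U_add_U (n : ℤ) :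
    (1 - X) * (U ℝ n + U ℝ (n - 1)) ^ 2 = 1 - T ℝ (2 * n + 1) := by
  have h1 := U_sq_add_U_sq n
  have h2 := T_mul_T ℝ (n + 1) n
  rw [show n + 1 + n = 2 * n + 1 by ring, show n + 1 - n = 1 by ring, T_one] at h2
  have h3 := T_eq_U_sub_X_mul_U ℝ n
  have h4 := T_eq_X_mul_U_sub_U ℝ (n - 1)
  rw [show n - 1 + 2 = n + 1 by ring, sub_add_cancel] at h4
  rw [h3, h4] at h2
  linear_combination (1 + X) * h1 - h2

/-- Bounding the square root by `3R/2` gives `log(5R/2)`, and `(5/2)³ ≤ 2⁴`. The factor `4/3` is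
good enough because `(2/3)² ≤ 1/2` in `exists_poly_ritz`. -/
lemma arsinh_le_log_two_mul {R : ℝ} (hR : 1 ≤ R) :
    Real.arsinh R ≤ 4 / 3 * Real.log (2 * R) := by
  have h1 : Real.sqrt (1 + R ^ 2) ≤ 3 / 2 * R := by
    rw [Real.sqrt_le_left (by positivity)]
    nlinarith
  have h2 : Real.arsinh R ≤ Real.log (5 / 2 * R) := by
    rw [Real.arsinh]
    apply Real.log_le_log (by positivity)
    linarith
  have h3 : Real.log ((5 / 2 * R) ^ 3) ≤ Real.log ((2 * R) ^ 4) := by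
    apply Real.log_le_log (by positivity)
    have : R ^ 3 ≤ R ^ 4 := pow_le_pow_right₀ hR (by norm_num)
    have h0 : 0 < R ^ 3 := by positivity
    nlinarith
  rw [Real.log_pow, Real.log_pow] at h3
  push_cast at h3
  linarith

/-- A polynomial of degree less than `t` that concentrates at the left end of `[0, D]`. -/
lemma exists_poly_ritz {t : ℕ} (ht : 0 < t) {D R : ℝ} (hD : 0 < D) (hR : 1 ≤ R) :
    ∃ (p : ℝ[X]) (η : ℝ), p.natDegree < t ∧ p.eval 0 ≠ 0 ∧ 0 < η ∧
      η ≤ Real.log (2 * R) ^ 2 / (2 * ((t : ℝ) - 1 / 2) ^ 2) ∧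
      ∀ e ∈ Set.Icc 0 D, (e - η * D) * p.eval e ^ 2 * R ^ 2 ≤ η * D * p.eval 0 ^ 2 := by
  have ht1 : (1 : ℝ) ≤ t := by exact_mod_cast ht
  have ht2 : (0 : ℝ) < t - 1 / 2 := by linarith
  -- Chosen so that `T_{2t-1}(cosh ψ) = 1 + 2 sinh²((t-½)ψ) = 1 + 2R²`.
  set ψ := Real.arsinh R / ((t : ℝ) - 1 / 2) with hψ
  have hars : 0 < Real.arsinh R := Real.arsinh_pos_iff.2 (by linarith)
  have hψ0 : 0 < ψ := div_pos hars ht2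
  have hS : 0 < Real.sinh (ψ / 2) := Real.sinh_pos_iff.2 (by positivity)
  have hC : 0 < Real.cosh (ψ / 2) := Real.cosh_pos _
  set S := Real.sinh (ψ / 2) with hSdef
  set K := Real.cosh (ψ / 2) with hKdef
  have hKS : K ^ 2 = S ^ 2 + 1 := Real.cosh_sq _
  have hcosh : Real.cosh ψ = 1 + 2 * S ^ 2 := cosh_eq_one_add_two_mul_sinh_sq ψ
  set W : ℝ[X] := U ℝ ((t : ℤ) - 1) + U ℝ ((t : ℤ) - 1 - 1) with hW
  have hWT : ∀ c : ℝ, (1 - c) * W.eval c ^ 2 = 1 - (T ℝ (2 * t - 1 : ℤ)).eval c := by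
    intro c
    have h := congrArg (eval c) (one_sub_X_mul_sq_U_add_U ((t : ℤ) - 1))
    rw [show 2 * ((t : ℤ) - 1) + 1 = 2 * t - 1 by ring] at h
    rw [hW, eval_add]
    simpa using h
  have hWdeg : W.natDegree < t := by
    obtain ⟨n, rfl⟩ : ∃ n, t = n + 1 := ⟨t - 1, by omega⟩
    refine Nat.lt_succ_of_le ((natDegree_add_le _ _).trans (max_le ?_ ?_))
    · simp
    · rw [natDegree_U]
      simp
  -- This affine map sends `0`, `ηD`, `D` to `cosh ψ`, `1`, `-1`, where `η = tanh²(ψ/2)`. Hence `1 -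
  -- c` becomes a multiple of `e - ηD`.
  set p : ℝ[X] := W.comp (Polynomial.C (-2 * K ^ 2 / D) * X + Polynomial.C (Real.cosh ψ)) with hp
  have hpe : ∀ e : ℝ, p.eval e = W.eval (Real.cosh ψ - 2 * K ^ 2 * (e / D)) := by
    intro e
    simp only [hp, eval_comp, eval_add, eval_mul, eval_C, eval_X]
    congr 1
    ring
  set η := S ^ 2 / K ^ 2 with hη
  have hηpos : 0 < η := by positivity
  have hid : ∀ e : ℝ, (e - η * D) * p.eval e ^ 2
      = D / (2 * K ^ 2) * (1 - (T ℝ (2 * t - 1 : ℤ)).eval (Real.cosh ψ - 2 * K ^ 2 * (e / D))) := by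
    intro e
    rw [← hWT, hpe, hcosh, hη]
    field_simp
    ring
  have hid0 : η * D * p.eval 0 ^ 2 = D / K ^ 2 * R ^ 2 := by
    have h := hid 0
    rw [zero_div, mul_zero, sub_zero, T_real_cosh, cosh_eq_one_add_two_mul_sinh_sq] at h
    have h2 : ((2 * t - 1 : ℤ) : ℝ) * ψ / 2 = Real.arsinh R := by
      rw [hψ]
      push_cast
      have h4 : ((t : ℝ) - 1 / 2) * (Real.arsinh R / (t - 1 / 2)) = Real.arsinh R :=
        mul_div_cancel₀ _ ht2.ne'
      linear_combination h4
    rw [h2, Real.sinh_arsinh] at h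
    have h3 : D / (2 * K ^ 2) * (1 - (1 + 2 * R ^ 2)) = - (D / K ^ 2 * R ^ 2) := by
      field_simp
      ring
    rw [h3] at h
    linarith
  refine ⟨p, η, ?_, ?_, hηpos, ?_, ?_⟩
  · exact lt_of_le_of_lt (natDegree_comp_linear_le _ _ _) hWdeg
  · intro h0
    rw [h0] at hid0
    have : 0 < D / K ^ 2 * R ^ 2 := by positivity
    rw [← hid0] at this
    simp at this
  · have h1 : Real.tanh (ψ / 2) ≤ ψ / 2 := tanh_le_self (by positivity)
    rw [Real.tanh_eq_sinh_div_cosh] at h1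
    have h2 : ψ / 2 ≤ 2 / 3 * Real.log (2 * R) / (t - 1 / 2) := by
      rw [hψ, div_right_comm]
      gcongr
      linarith [arsinh_le_log_two_mul hR]
    have h3 : η ≤ (2 / 3 * Real.log (2 * R) / (t - 1 / 2)) ^ 2 := by
      rw [hη, ← div_pow]
      exact pow_le_pow_left₀ (by positivity) (h1.trans h2) 2
    refine h3.trans ?_
    rw [div_pow, mul_pow, ← div_div]
    gcongr
    nlinarith [sq_nonneg (Real.log (2 * R))]
  · rintro e ⟨he0, heD⟩
    rcases le_total e (η * D) with h | h
    · have h1 : (e - η * D) * p.eval e ^ 2 * R ^ 2 ≤ 0 := by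
        rw [mul_assoc]
        exact mul_nonpos_of_nonpos_of_nonneg (by linarith) (by positivity)
      exact h1.trans (by positivity)
    · rw [hid0, hid]
      have hc1 : -1 ≤ Real.cosh ψ - 2 * K ^ 2 * (e / D) := by
        have h1 : e / D ≤ 1 := (div_le_one hD).2 heD
        have h2 : 2 * K ^ 2 * (e / D) ≤ 2 * K ^ 2 * 1 := by gcongr
        rw [hcosh]; linarith
      have hc2 : Real.cosh ψ - 2 * K ^ 2 * (e / D) ≤ 1 := by
        have h1 : η ≤ e / D := (le_div_iff₀ hD).2 h
        have h2 : 2 * K ^ 2 * η ≤ 2 * K ^ 2 * (e / D) := by gcongr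
        have h3 : 2 * K ^ 2 * η = 2 * S ^ 2 := by rw [hη]; field_simp
        rw [hcosh]; linarith
      have hT := eval_T_real_mem_Icc (2 * t - 1 : ℤ)
        (x := Real.cosh ψ - 2 * K ^ 2 * (e / D)) ⟨hc1, hc2⟩
      gcongr ?_ * R ^ 2
      calc _ ≤ D / (2 * K ^ 2) * 2 := by gcongr; linarith [hT.1]
        _ = D / K ^ 2 := by field_simp

end KrylovCubic

/-! ### Eigenbasis coordinates and polynomials in `A` applied to `b`. -/

namespace KrylovCubic

open Polynomial

section Spectral

variable {d : ℕ} {A : Matrix (Fin d) (Fin d) ℝ}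

lemma inner_toEuclideanLin_comm (hA : A.IsHermitian) (x y : EuclideanSpace ℝ (Fin d)) :
    inner ℝ x (Matrix.toEuclideanLin A y) = inner ℝ (Matrix.toEuclideanLin A x) y :=
  ((Matrix.isSymmetric_toEuclideanLin_iff.2 hA) x y).symm

lemma toEuclideanLin_eigenvectorBasis (hA : A.IsHermitian) (i : Fin d) :
    Matrix.toEuclideanLin A (hA.eigenvectorBasis i) = hA.eigenvalues i • hA.eigenvectorBasis i := by
  apply (WithLp.equiv 2 (Fin d → ℝ)).injective
  simpa [Matrix.ofLp_toLpLin] using hA.mulVec_eigenvectorBasis i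

lemma inner_eigenvectorBasis_toEuclideanLin (hA : A.IsHermitian) (i : Fin d)
    (v : EuclideanSpace ℝ (Fin d)) :
    inner ℝ (hA.eigenvectorBasis i) (Matrix.toEuclideanLin A v)
      = hA.eigenvalues i * inner ℝ (hA.eigenvectorBasis i) v := by
  rw [inner_toEuclideanLin_comm hA, toEuclideanLin_eigenvectorBasis, real_inner_smul_left]

lemma inner_eigenvectorBasis_aeval (hA : A.IsHermitian) (i : Fin d) (p : ℝ[X])
    (v : EuclideanSpace ℝ (Fin d)) :
    inner ℝ (hA.eigenvectorBasis i) (aeval (Matrix.toEuclideanLin A) p v)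
      = p.eval (hA.eigenvalues i) * inner ℝ (hA.eigenvectorBasis i) v := by
  induction p using Polynomial.induction_on generalizing v with
  | C a => simp [Module.algebraMap_end_apply, real_inner_smul_right]
  | add p q hp hq => simp [inner_add_right, hp, hq, add_mul]
  | monomial n a ih =>
    rw [pow_succ, ← mul_assoc, map_mul, Module.End.mul_apply, aeval_X, ih,
      inner_eigenvectorBasis_toEuclideanLin]
    simp
    ring

lemma norm_sq_eq_sum_inner (hA : A.IsHermitian) (v : EuclideanSpace ℝ (Fin d)) :
    ‖v‖ ^ 2 = ∑ i, inner ℝ (hA.eigenvectorBasis i) v ^ 2 := by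
  rw [← hA.eigenvectorBasis.sum_sq_norm_inner_right v]
  simp

lemma inner_toEuclideanLin_self_eq_sum (hA : A.IsHermitian) (v : EuclideanSpace ℝ (Fin d)) :
    inner ℝ v (Matrix.toEuclideanLin A v)
      = ∑ i, hA.eigenvalues i * inner ℝ (hA.eigenvectorBasis i) v ^ 2 := by
  rw [← hA.eigenvectorBasis.sum_inner_mul_inner]
  refine Finset.sum_congr rfl fun i _ => ?_
  rw [inner_eigenvectorBasis_toEuclideanLin, real_inner_comm]
  ring

lemma lambdaMin_le_eigenvalues (hA : A.IsHermitian) (i : Fin d) :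
    lambdaMin A ≤ hA.eigenvalues i :=
  csInf_le A.finite_real_spectrum.bddBelow (hA.eigenvalues_mem_spectrum_real i)

lemma eigenvalues_le_lambdaMax (hA : A.IsHermitian) (i : Fin d) :
    hA.eigenvalues i ≤ lambdaMax A :=
  le_csSup A.finite_real_spectrum.bddAbove (hA.eigenvalues_mem_spectrum_real i)

lemma exists_eigenvalues_eq_lambdaMin [NeZero d] (hA : A.IsHermitian) :
    ∃ i, hA.eigenvalues i = lambdaMin A := by
  have h : lambdaMin A ∈ spectrum ℝ A :=
    Set.Nonempty.csInf_mem ⟨_, hA.eigenvalues_mem_spectrum_real 0⟩ A.finite_real_spectrum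
  rw [hA.spectrum_real_eq_range_eigenvalues] at h
  exact h

lemma lambdaMin_le_lambdaMax (A : Matrix (Fin d) (Fin d) ℝ) (hA : A.IsHermitian) :
    lambdaMin A ≤ lambdaMax A := by
  rcases Nat.eq_zero_or_pos d with rfl | hd
  -- In dimension zero the spectrum is empty, and both extremal values default to `0`.
  · simp [lambdaMin, lambdaMax, spectrum.of_subsingleton]
  · exact (lambdaMin_le_eigenvalues hA ⟨0, hd⟩).trans (eigenvalues_le_lambdaMax hA _)

lemma toEuclideanLin_pow (A : Matrix (Fin d) (Fin d) ℝ) (k : ℕ) :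
    Matrix.toEuclideanLin (A ^ k) = Matrix.toEuclideanLin A ^ k := by
  induction k with
  | zero =>
    ext v : 1
    simp
  | succ k ih =>
    rw [pow_succ, pow_succ, ← ih]
    ext v : 1
    simp

lemma aeval_mem_krylov (b : EuclideanSpace ℝ (Fin d)) {t : ℕ} {p : ℝ[X]} (hp : p.natDegree < t) :
    aeval (Matrix.toEuclideanLin A) p b ∈ krylov A b t := by
  rw [aeval_eq_sum_range' hp, LinearMap.sum_apply]
  refine Submodule.sum_mem _ fun k hk => ?_
  rw [LinearMap.smul_apply, ← toEuclideanLin_pow]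
  exact Submodule.smul_mem _ _ (Submodule.subset_span ⟨⟨k, Finset.mem_range.1 hk⟩, rfl⟩)

/-- If `(A + μ) s = -b` and `q` has degree at most `t` and `q(0) = 1`, then `s - q(A + μ) s`
lies in the Krylov subspace of order `t`. -/
lemma exists_mem_krylov_of_poly (hA : A.IsHermitian) {b s : EuclideanSpace ℝ (Fin d)} {μ : ℝ}
    (hs : Matrix.toEuclideanLin A s + μ • s = -b) {t : ℕ} (ht : 0 < t) {q : ℝ[X]}
    (hq : q.natDegree ≤ t) (hq0 : q.eval 0 = 1) :
    ∃ y ∈ krylov A b t, ∀ i, inner ℝ (hA.eigenvectorBasis i) y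
      = (1 - q.eval (hA.eigenvalues i + μ)) * inner ℝ (hA.eigenvectorBasis i) s := by
  -- Since `q(x) = 1 + x p(x)` and `(A+μ)s = -b`, the vector `s - q(A+μ)s` equals `p(A+μ)b`, with
  -- `deg p < t`.
  set p : ℝ[X] := divX q with hp
  have hqp : ∀ x : ℝ, q.eval x = x * p.eval x + 1 := by
    intro x
    conv_lhs => rw [← divX_mul_X_add q, coeff_zero_eq_eval_zero, hq0]
    simp [hp, mul_comm]
  have hdeg : (p.comp (X + C μ)).natDegree < t := by
    rw [natDegree_comp, natDegree_X_add_C, mul_one, hp, natDegree_divX_eq_natDegree_tsub_one]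
    omega
  refine ⟨_, aeval_mem_krylov b hdeg, fun i => ?_⟩
  have hb : inner ℝ (hA.eigenvectorBasis i) b
      = -((hA.eigenvalues i + μ) * inner ℝ (hA.eigenvectorBasis i) s) := by
    have h := congrArg (inner ℝ (hA.eigenvectorBasis i)) hs
    rw [inner_add_right, inner_eigenvectorBasis_toEuclideanLin, real_inner_smul_right,
      inner_neg_right] at h
    linarith
  rw [inner_eigenvectorBasis_aeval, hb, hqp]
  simp
  ring

end Spectral

end KrylovCubic

/-! ### Optimality conditions and the exact formula for the gap. -/

namespace KrylovCubic

section Optimality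

variable {d : ℕ} {A : Matrix (Fin d) (Fin d) ℝ}

/-- The quadratic form `vᵀ (A + μ I) v`. -/
noncomputable def shiftedForm (A : Matrix (Fin d) (Fin d) ℝ) (μ : ℝ)
    (v : EuclideanSpace ℝ (Fin d)) : ℝ :=
  inner ℝ v (Matrix.toEuclideanLin A v) + μ * ‖v‖ ^ 2

lemma shiftedForm_eq_sum (hA : A.IsHermitian) (μ : ℝ) (v : EuclideanSpace ℝ (Fin d)) :
    shiftedForm A μ v
      = ∑ i, (hA.eigenvalues i + μ) * inner ℝ (hA.eigenvectorBasis i) v ^ 2 := by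
  rw [shiftedForm, inner_toEuclideanLin_self_eq_sum hA, norm_sq_eq_sum_inner hA, Finset.mul_sum,
    ← Finset.sum_add_distrib]
  exact Finset.sum_congr rfl fun i _ => by ring

lemma shiftedForm_smul (A : Matrix (Fin d) (Fin d) ℝ) (μ c : ℝ) (v : EuclideanSpace ℝ (Fin d)) :
    shiftedForm A μ (c • v) = c ^ 2 * shiftedForm A μ v := by
  rw [shiftedForm, shiftedForm, map_smul, real_inner_smul_left, real_inner_smul_right, norm_smul,
    mul_pow, Real.norm_eq_abs, sq_abs]
  ring

lemma shiftedForm_add (hA : A.IsHermitian) (μ : ℝ) (v w : EuclideanSpace ℝ (Fin d)) :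
    shiftedForm A μ (v + w) = shiftedForm A μ v + shiftedForm A μ w
      + 2 * (inner ℝ v (Matrix.toEuclideanLin A w) + μ * inner ℝ v w) := by
  simp only [shiftedForm, map_add, inner_add_left, inner_add_right, norm_add_sq_real]
  rw [inner_toEuclideanLin_comm hA w v, real_inner_comm _ (Matrix.toEuclideanLin A w)]
  ring

lemma quad_sub_quad (hA : A.IsHermitian) {b s : EuclideanSpace ℝ (Fin d)} {μ : ℝ}
    (hs : Matrix.toEuclideanLin A s + μ • s = -b) (x : EuclideanSpace ℝ (Fin d)) :
    quad A b x - quad A b s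
      = 1 / 2 * shiftedForm A μ (x - s) + μ / 2 * (‖s‖ ^ 2 - ‖x‖ ^ 2) := by
  obtain ⟨v, rfl⟩ : ∃ v, x = s + v := ⟨x - s, by abel⟩
  obtain rfl : b = -(Matrix.toEuclideanLin A s + μ • s) := by rw [hs, neg_neg]
  simp only [quad, shiftedForm, add_sub_cancel_left, map_add, inner_add_left, inner_add_right,
    inner_neg_left, real_inner_smul_left, norm_add_sq_real]
  rw [inner_toEuclideanLin_comm hA s v, real_inner_comm _ (Matrix.toEuclideanLin A s)]
  ring

/-- The norm terms combine through `2a³ - 3a²c + c³ = (c-a)²(2a+c)` with `a = ‖x‖`, `c = ‖s‖`. Only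
stationarity of `s` enters, so the formula also serves to derive the second-order condition. -/
lemma cubic_sub_cubic (hA : A.IsHermitian) {b s : EuclideanSpace ℝ (Fin d)} {ρ : ℝ}
    (hs : Matrix.toEuclideanLin A s + (ρ * ‖s‖) • s = -b) (x : EuclideanSpace ℝ (Fin d)) :
    cubic A b ρ x - cubic A b ρ s = 1 / 2 * shiftedForm A (ρ * ‖s‖) (x - s)
      + ρ / 6 * ((‖s‖ - ‖x‖) ^ 2 * (2 * ‖x‖ + ‖s‖)) := by
  have h := quad_sub_quad hA hs x
  simp only [cubic]
  linear_combination h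

lemma nonneg_of_forall_add_mul {a C : ℝ} (h : ∀ ε : ℝ, 0 < ε → ε ≤ 1 → 0 ≤ a + ε * C) : 0 ≤ a := by
  rcases le_or_gt C 0 with hC | hC
  · linarith [h 1 one_pos le_rfl]
  · by_contra! ha
    have hpos : 0 < -a / (2 * C) := div_pos (by linarith) (by linarith)
    have h1 := h (min 1 (-a / (2 * C))) (lt_min one_pos hpos) (min_le_left _ _)
    have h2 := mul_le_mul_of_nonneg_right (min_le_right 1 (-a / (2 * C))) hC.le
    have h3 : -a / (2 * C) * C = -a / 2 := by field_simp
    linarith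

/-- A step `-εg` along the gradient changes the objective by `-ε‖g‖² + O(ε²)`. An explicit bound on
the second-order term replaces differentiation of the cubed norm. -/
lemma stationary_of_isMinimizer (hA : A.IsHermitian) {b s : EuclideanSpace ℝ (Fin d)} {ρ : ℝ}
    (hρ : 0 ≤ ρ) (hs : IsMinimizer (cubic A b ρ) Set.univ s) :
    Matrix.toEuclideanLin A s + (ρ * ‖s‖) • s = -b := by
  set g := Matrix.toEuclideanLin A s + (ρ * ‖s‖) • s + b with hg
  suffices h : g = 0 by rw [hg] at h; exact eq_neg_of_add_eq_zero_left h
  have key : 0 ≤ -‖g‖ ^ 2 := by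
    refine nonneg_of_forall_add_mul (C := 1 / 2 * shiftedForm A (ρ * ‖s‖) g
      + ρ / 6 * (‖g‖ ^ 2 * (2 * (‖s‖ + ‖g‖) + ‖s‖))) fun ε hε hε1 => ?_
    have hmin := hs.2 (s + (-ε) • g) (Set.mem_univ _)
    set x := s + (-ε) • g with hx
    have hx2 : ‖x‖ ^ 2 = ‖s‖ ^ 2 - 2 * ε * inner ℝ s g + ε ^ 2 * ‖g‖ ^ 2 := by
      rw [hx, norm_add_sq_real, real_inner_smul_right, norm_smul, mul_pow, Real.norm_eq_abs, sq_abs]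
      ring
    have hgg : inner ℝ s (Matrix.toEuclideanLin A g) + ρ * ‖s‖ * inner ℝ s g + inner ℝ b g
        = ‖g‖ ^ 2 := by
      rw [← real_inner_self_eq_norm_sq g]
      conv_rhs => rw [hg, inner_add_left, inner_add_left, real_inner_smul_left]
      rw [← hg, inner_toEuclideanLin_comm hA]
    have hquad : quad A b x = quad A b s - ε * (inner ℝ s (Matrix.toEuclideanLin A g) + inner ℝ b g)
        + ε ^ 2 / 2 * inner ℝ g (Matrix.toEuclideanLin A g) := by
      simp only [quad, hx, map_add, map_smul, inner_add_left, inner_add_right,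
        real_inner_smul_left, real_inner_smul_right]
      rw [inner_toEuclideanLin_comm hA s g, real_inner_comm _ (Matrix.toEuclideanLin A s)]
      ring
    have hnear : |‖s‖ - ‖x‖| ≤ ε * ‖g‖ := by
      refine (abs_norm_sub_norm_le s x).trans (le_of_eq ?_)
      rw [hx, sub_add_cancel_left, norm_neg, norm_smul, norm_neg, Real.norm_eq_abs, abs_of_pos hε]
    have hnear2 : (‖s‖ - ‖x‖) ^ 2 ≤ ε ^ 2 * ‖g‖ ^ 2 := by
      rw [← sq_abs, ← mul_pow]
      exact pow_le_pow_left₀ (abs_nonneg _) hnear 2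
    have hxle : ‖x‖ ≤ ‖s‖ + ‖g‖ := by
      have := (abs_le.1 hnear).1
      have := mul_le_of_le_one_left (norm_nonneg g) hε1
      linarith
    have hcub : ρ / 6 * ((‖s‖ - ‖x‖) ^ 2 * (2 * ‖x‖ + ‖s‖))
        ≤ ρ / 6 * (ε ^ 2 * ‖g‖ ^ 2 * (2 * (‖s‖ + ‖g‖) + ‖s‖)) := by gcongr
    have hexp : cubic A b ρ x - cubic A b ρ s
        = ε * (-‖g‖ ^ 2 + ε * (1 / 2 * shiftedForm A (ρ * ‖s‖) g))
          + ρ / 6 * ((‖s‖ - ‖x‖) ^ 2 * (2 * ‖x‖ + ‖s‖)) := by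
      simp only [cubic, shiftedForm, hquad]
      linear_combination ρ / 2 * ‖s‖ * hx2 - ε * hgg
    refine nonneg_of_mul_nonneg_right (a := ε) ?_ hε
    calc 0 ≤ cubic A b ρ x - cubic A b ρ s := sub_nonneg.2 hmin
      _ ≤ ε * (-‖g‖ ^ 2 + ε * (1 / 2 * shiftedForm A (ρ * ‖s‖) g))
          + ρ / 6 * (ε ^ 2 * ‖g‖ ^ 2 * (2 * (‖s‖ + ‖g‖) + ‖s‖)) := by rw [hexp]; gcongr
      _ = _ := by ring
  have : ‖g‖ ^ 2 ≤ 0 := by linarith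
  exact norm_eq_zero.1 (pow_eq_zero_iff two_ne_zero |>.1 (le_antisymm this (sq_nonneg _)))

/-- A line through `s` in a direction `w` not orthogonal to `s` meets the sphere of radius `‖s‖`
again, and there the gap is exactly a positive multiple of the form at `w`. Orthogonal directions
follow by perturbing with `εs`; for `s = 0` the cubic term is of higher order. -/
lemma shiftedForm_nonneg_of_isMinimizer (hA : A.IsHermitian) {b s : EuclideanSpace ℝ (Fin d)}
    {ρ : ℝ} (hρ : 0 ≤ ρ) (hs : IsMinimizer (cubic A b ρ) Set.univ s)
    (v : EuclideanSpace ℝ (Fin d)) : 0 ≤ shiftedForm A (ρ * ‖s‖) v := by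
  have hstat := stationary_of_isMinimizer hA hρ hs
  rcases eq_or_ne s 0 with hs0 | hs0
  · refine nonneg_of_forall_add_mul (C := 2 / 3 * ρ * ‖v‖ ^ 3) fun ε hε _ => ?_
    have h := sub_nonneg.2 (hs.2 (ε • v) (Set.mem_univ _))
    rw [cubic_sub_cubic hA hstat] at h
    simp only [hs0, sub_zero, shiftedForm_smul, norm_smul, Real.norm_eq_abs, abs_of_pos hε,
      norm_zero, mul_zero] at h ⊢
    refine nonneg_of_mul_nonneg_right (a := ε ^ 2) ?_ (by positivity)
    linarith
  · have hgen : ∀ w : EuclideanSpace ℝ (Fin d), inner ℝ w s ≠ 0 →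
        0 ≤ shiftedForm A (ρ * ‖s‖) w := by
      intro w hw
      have hw0 : w ≠ 0 := by rintro rfl; simp at hw
      have hwn : ‖w‖ ≠ 0 := norm_ne_zero_iff.2 hw0
      set c := -2 * inner ℝ w s / ‖w‖ ^ 2 with hc
      have hc0 : c ≠ 0 := by
        rw [hc]
        exact div_ne_zero (mul_ne_zero (by norm_num) hw) (pow_ne_zero 2 hwn)
      have hnorm : ‖s + c • w‖ = ‖s‖ := by
        refine (sq_eq_sq₀ (norm_nonneg _) (norm_nonneg _)).1 ?_
        rw [norm_add_sq_real, real_inner_smul_right, norm_smul, mul_pow, Real.norm_eq_abs, sq_abs,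
          real_inner_comm, hc]
        field_simp
        ring
      have h := sub_nonneg.2 (hs.2 (s + c • w) (Set.mem_univ _))
      rw [cubic_sub_cubic hA hstat, hnorm, add_sub_cancel_left, shiftedForm_smul] at h
      refine nonneg_of_mul_nonneg_right (a := c ^ 2) ?_ (by positivity)
      linarith
    by_cases hv : inner ℝ v s = 0
    · refine nonneg_of_forall_add_mul
        (C := 2 * (inner ℝ v (Matrix.toEuclideanLin A s) + ρ * ‖s‖ * inner ℝ v s)
          + |shiftedForm A (ρ * ‖s‖) s|) fun ε hε hε1 => ?_
      have h := hgen (v + ε • s) (by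
        rw [inner_add_left, hv, zero_add, real_inner_smul_left, real_inner_self_eq_norm_sq]
        exact mul_ne_zero hε.ne' (pow_ne_zero 2 (norm_ne_zero_iff.2 hs0)))
      rw [shiftedForm_add hA, shiftedForm_smul, map_smul, real_inner_smul_right,
        real_inner_smul_right] at h
      have h1 : ε ^ 2 * shiftedForm A (ρ * ‖s‖) s ≤ ε * |shiftedForm A (ρ * ‖s‖) s| :=
        (mul_le_mul_of_nonneg_left (le_abs_self _) (sq_nonneg ε)).trans
          (mul_le_mul_of_nonneg_right (by nlinarith) (abs_nonneg _))
      linarith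
    · exact hgen v hv

lemma lambdaMin_add_nonneg (hA : A.IsHermitian) {b s : EuclideanSpace ℝ (Fin d)}
    {ρ : ℝ} (hρ : 0 ≤ ρ) (hs : IsMinimizer (cubic A b ρ) Set.univ s) :
    0 ≤ lambdaMin A + ρ * ‖s‖ := by
  rcases Nat.eq_zero_or_pos d with rfl | hd
  · simp only [lambdaMin, spectrum.of_subsingleton, Real.sInf_empty, zero_add]
    positivity
  · have : NeZero d := ⟨hd.ne'⟩
    obtain ⟨i, hi⟩ := exists_eigenvalues_eq_lambdaMin hA
    have h := shiftedForm_nonneg_of_isMinimizer hA hρ hs (hA.eigenvectorBasis i)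
    rw [shiftedForm, toEuclideanLin_eigenvectorBasis, real_inner_smul_right,
      real_inner_self_eq_norm_sq, hA.eigenvectorBasis.norm_eq_one, hi] at h
    linarith

end Optimality

end KrylovCubic

/-! ### Test vectors and the convergence rates. -/

namespace KrylovCubic

open Polynomial

section Rates

variable {d : ℕ} {A : Matrix (Fin d) (Fin d) ℝ}

lemma shiftedForm_le_mul (hA : A.IsHermitian) {μ κ : ℝ} (hμ : ∀ i, 0 ≤ hA.eigenvalues i + μ)
    {v s : EuclideanSpace ℝ (Fin d)} {m : Fin d → ℝ}
    (hv : ∀ i, inner ℝ (hA.eigenvectorBasis i) v = m i * inner ℝ (hA.eigenvectorBasis i) s)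
    (hm : ∀ i, m i ^ 2 ≤ κ) : shiftedForm A μ v ≤ κ * shiftedForm A μ s := by
  rw [shiftedForm_eq_sum hA, shiftedForm_eq_sum hA, Finset.mul_sum]
  refine Finset.sum_le_sum fun i _ => ?_
  rw [hv, mul_pow]
  calc (hA.eigenvalues i + μ) * (m i ^ 2 * inner ℝ (hA.eigenvectorBasis i) s ^ 2)
      = m i ^ 2 * ((hA.eigenvalues i + μ) * inner ℝ (hA.eigenvectorBasis i) s ^ 2) := by ring
    _ ≤ _ := mul_le_mul_of_nonneg_right (hm i) (mul_nonneg (hμ i) (sq_nonneg _))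

lemma norm_sq_le_mul (hA : A.IsHermitian) {κ : ℝ} {v s : EuclideanSpace ℝ (Fin d)} {m : Fin d → ℝ}
    (hv : ∀ i, inner ℝ (hA.eigenvectorBasis i) v = m i * inner ℝ (hA.eigenvectorBasis i) s)
    (hm : ∀ i, m i ^ 2 ≤ κ) : ‖v‖ ^ 2 ≤ κ * ‖s‖ ^ 2 := by
  rw [norm_sq_eq_sum_inner hA, norm_sq_eq_sum_inner hA, Finset.mul_sum]
  refine Finset.sum_le_sum fun i _ => ?_
  rw [hv, mul_pow]
  exact mul_le_mul_of_nonneg_right (hm i) (sq_nonneg _)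

/-- Given `q` with `q(0) = 1`, `deg q ≤ t` and `|q| ≤ ε ≤ 1/3` on the spectrum of `A + μ`, the
Krylov subspace contains a vector of norm `‖s‖` that is `O(ε)`-close to `s` in energy. -/
lemma exists_mem_krylov_energy_le (hA : A.IsHermitian) {b s : EuclideanSpace ℝ (Fin d)} {μ ε : ℝ}
    (hs : Matrix.toEuclideanLin A s + μ • s = -b) (hs0 : s ≠ 0)
    (hμ : ∀ i, 0 ≤ hA.eigenvalues i + μ)
    {t : ℕ} (ht : 0 < t) {q : ℝ[X]} (hq : q.natDegree ≤ t) (hq0 : q.eval 0 = 1)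
    (hε0 : 0 ≤ ε) (hε : ε ≤ 1 / 3) (hqε : ∀ i, |q.eval (hA.eigenvalues i + μ)| ≤ ε) :
    ∃ x ∈ krylov A b t, ‖x‖ = ‖s‖ ∧
      shiftedForm A μ (x - s) ≤ 9 * ε ^ 2 * shiftedForm A μ s := by
  obtain ⟨y, hyK, hy⟩ := exists_mem_krylov_of_poly hA hs ht hq hq0
  have hsn : 0 < ‖s‖ := norm_pos_iff.2 hs0
  have hdist : ‖y - s‖ ≤ ε * ‖s‖ := by
    have h : ‖y - s‖ ^ 2 ≤ ε ^ 2 * ‖s‖ ^ 2 := by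
      refine norm_sq_le_mul hA (m := fun i => -q.eval (hA.eigenvalues i + μ)) (fun i => ?_) fun i => ?_
      · rw [inner_sub_right, hy]; ring
      · rw [neg_sq]; exact sq_le_sq' (by linarith [(abs_le.1 (hqε i)).1]) (abs_le.1 (hqε i)).2
    rw [← mul_pow] at h
    exact le_of_sq_le_sq h (by positivity)
  have hdist' := (abs_norm_sub_norm_le y s).trans hdist
  -- The norm of `y` is within `ε‖s‖` of `‖s‖`, so the rescaling `c` lies between `1/(1+ε)` and
  -- `1/(1-ε)`. Each coordinate factor is then at most `2ε/(1-ε) ≤ 3ε` in absolute value.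
  rw [abs_le] at hdist'
  have hyn : 0 < ‖y‖ := by nlinarith
  set c := ‖s‖ / ‖y‖ with hc
  have hc0 : 0 ≤ c := by positivity
  have hcy : c * ‖y‖ = ‖s‖ := div_mul_cancel₀ _ hyn.ne'
  have hc1 : c * (1 - ε) ≤ 1 := by
    rw [hc, div_mul_eq_mul_div, div_le_one hyn]; nlinarith
  have hc2 : 1 ≤ c * (1 + ε) := by
    rw [hc, div_mul_eq_mul_div, one_le_div hyn]; nlinarith
  refine ⟨c • y, Submodule.smul_mem _ _ hyK, ?_, ?_⟩
  · rw [norm_smul, Real.norm_eq_abs, abs_of_nonneg hc0, hcy]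
  · refine shiftedForm_le_mul hA hμ
      (m := fun i => c * (1 - q.eval (hA.eigenvalues i + μ)) - 1) (fun i => ?_) fun i => ?_
    · rw [inner_sub_right, real_inner_smul_right, hy]; ring
    · obtain ⟨h1, h2⟩ := abs_le.1 (hqε i)
      have h3 : c * (1 - q.eval (hA.eigenvalues i + μ)) ≤ c * (1 + ε) :=
        mul_le_mul_of_nonneg_left (by linarith) hc0
      have h4 : c * (1 - ε) ≤ c * (1 - q.eval (hA.eigenvalues i + μ)) :=
        mul_le_mul_of_nonneg_left (by linarith) hc0
      have h5 : (9 : ℝ) * ε ^ 2 = (3 * ε) ^ 2 := by ring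
      have h6 : c ≤ 3 / 2 := by nlinarith
      rw [h5]
      refine sq_le_sq' ?_ ?_ <;> nlinarith

theorem linear_rate (hA : A.IsHermitian) {b : EuclideanSpace ℝ (Fin d)} {ρ : ℝ} (hρ : 0 ≤ ρ)
    {s : EuclideanSpace ℝ (Fin d)} (hs : IsMinimizer (cubic A b ρ) Set.univ s)
    {t : ℕ} (ht : 0 < t) {st : EuclideanSpace ℝ (Fin d)}
    (hst : IsMinimizer (cubic A b ρ) (krylov A b t) st) :
    cubic A b ρ st - cubic A b ρ s ≤ 36 * (cubic A b ρ 0 - cubic A b ρ s) *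
      Real.exp (-4 * (t : ℝ) *
        Real.sqrt ((lambdaMin A + ρ * ‖s‖) / (lambdaMax A + ρ * ‖s‖))) := by
  set μ := ρ * ‖s‖ with hμdef
  set w := Real.sqrt ((lambdaMin A + μ) / (lambdaMax A + μ)) with hw
  have hstat := stationary_of_isMinimizer hA hρ hs
  have hθ := lambdaMin_add_nonneg hA hρ hs
  have hΔ : 0 ≤ cubic A b ρ 0 - cubic A b ρ s := sub_nonneg.2 (hs.2 0 (Set.mem_univ _))
  have hgap : cubic A b ρ st ≤ cubic A b ρ 0 := hst.2 0 (Submodule.zero_mem _)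
  -- At or above `1/36` comparison with the zero vector suffices. Below it `ε² < 1/9`, as the energy
  -- estimate needs, and the quotient is nonzero.
  rcases le_or_gt (1 / 36) (Real.exp (-4 * (t : ℝ) * w)) with hbig | hsmall
  · nlinarith [mul_le_mul_of_nonneg_left hbig hΔ]
  rcases eq_or_ne s 0 with hs0 | hs0
  · rw [← hs0] at hgap ⊢
    simpa using hgap
  have hwpos : 0 < w := by
    by_contra! h
    have : w = 0 := le_antisymm h (Real.sqrt_nonneg _)
    rw [this] at hsmall
    norm_num at hsmall
  have hθpos : 0 < lambdaMin A + μ := by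
    refine lt_of_le_of_ne hθ fun h => ?_
    rw [hw, ← h] at hwpos
    simp at hwpos
  have hD : 0 ≤ lambdaMax A - lambdaMin A := sub_nonneg.2 (lambdaMin_le_lambdaMax A hA)
  obtain ⟨q, hq, hq0, hqb⟩ := exists_poly_linear_rate ht hθpos hD
  rw [show lambdaMin A + μ + (lambdaMax A - lambdaMin A) = lambdaMax A + μ by ring, ← hw] at hqb
  set ε := 2 * Real.exp (-2 * t * w) with hε
  have hε2 : ε ^ 2 = 4 * Real.exp (-4 * t * w) := by
    rw [hε, mul_pow, ← Real.exp_nat_mul]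
    norm_num
    ring
  have hε0 : 0 ≤ ε := by positivity
  have hε3 : ε ≤ 1 / 3 := by nlinarith
  have hμ : ∀ i, 0 ≤ hA.eigenvalues i + μ := fun i =>
    hθ.trans (by linarith [lambdaMin_le_eigenvalues hA i])
  obtain ⟨x, hxK, hxn, hxe⟩ := exists_mem_krylov_energy_le hA hstat hs0 hμ ht hq hq0 hε0 hε3
    fun i => hqb _ ⟨by linarith [lambdaMin_le_eigenvalues hA i],
      by linarith [eigenvalues_le_lambdaMax hA i]⟩
  have h1 : cubic A b ρ x - cubic A b ρ s = 1 / 2 * shiftedForm A μ (x - s) := by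
    rw [cubic_sub_cubic hA hstat, hxn]; ring
  have h2 : 1 / 2 * shiftedForm A μ s ≤ cubic A b ρ 0 - cubic A b ρ s := by
    rw [cubic_sub_cubic hA hstat, zero_sub, ← neg_one_smul ℝ s, shiftedForm_smul]
    have : 0 ≤ ρ / 6 * ((‖s‖ - ‖(0 : EuclideanSpace ℝ (Fin d))‖) ^ 2
        * (2 * ‖(0 : EuclideanSpace ℝ (Fin d))‖ + ‖s‖)) := by positivity
    linarith
  rw [hε2] at hxe
  have h3 := mul_le_mul_of_nonneg_right h2 (Real.exp_pos (-4 * (t : ℝ) * w)).le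
  linarith [hst.2 x hxK]

/-- The Krylov subspace contains an approximate eigenvector for the smallest eigenvalue. -/
lemma exists_mem_krylov_ritz (hA : A.IsHermitian) {b u : EuclideanSpace ℝ (Fin d)} (hu : ‖u‖ = 1)
    (hAu : Matrix.toEuclideanLin A u = lambdaMin A • u) (hub : inner ℝ u b ≠ 0)
    {t : ℕ} (ht : 0 < t) {D : ℝ} (hD : 0 < D) (hDA : lambdaMax A - lambdaMin A ≤ D) :
    ∃ z ∈ krylov A b t, ‖z‖ = 1 ∧ inner ℝ z (Matrix.toEuclideanLin A z) ≤ lambdaMin A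
      + D * (Real.log (4 * ‖b‖ ^ 2 / inner ℝ u b ^ 2) ^ 2 / (8 * ((t : ℝ) - 1 / 2) ^ 2)) := by
  set R := ‖b‖ / |inner ℝ u b| with hRdef
  have hub' : 0 < |inner ℝ u b| := abs_pos.2 hub
  have hR : 1 ≤ R := by
    rw [hRdef, one_le_div hub']
    simpa [hu] using abs_real_inner_le_norm u b
  have hRsq : R ^ 2 * inner ℝ u b ^ 2 = ‖b‖ ^ 2 := by
    rw [← sq_abs (inner ℝ u b), ← mul_pow, hRdef, div_mul_cancel₀ _ hub'.ne']
  have hlog : Real.log (4 * ‖b‖ ^ 2 / inner ℝ u b ^ 2) = 2 * Real.log (2 * R) := by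
    rw [← hRsq, show 4 * (R ^ 2 * inner ℝ u b ^ 2) / inner ℝ u b ^ 2 = (2 * R) ^ 2 by
      field_simp; ring, Real.log_pow]
    norm_num
  obtain ⟨p, η, hpdeg, hp0, hη0, hη, hp⟩ := exists_poly_ritz ht hD hR
  have hdeg : (p.comp (X - C (lambdaMin A))).natDegree < t := by
    rw [natDegree_comp, natDegree_X_sub_C, mul_one]; exact hpdeg
  set v := aeval (Matrix.toEuclideanLin A) (p.comp (X - C (lambdaMin A))) b with hv
  have hvi : ∀ i, inner ℝ (hA.eigenvectorBasis i) v
      = p.eval (hA.eigenvalues i - lambdaMin A) * inner ℝ (hA.eigenvectorBasis i) b := by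
    intro i
    rw [hv, inner_eigenvectorBasis_aeval]
    simp
  have hui : ∀ i, hA.eigenvalues i ≠ lambdaMin A → inner ℝ (hA.eigenvectorBasis i) u = 0 := by
    intro i hi
    have h := inner_eigenvectorBasis_toEuclideanLin hA i u
    rw [hAu, real_inner_smul_right] at h
    have h' : (hA.eigenvalues i - lambdaMin A) * inner ℝ (hA.eigenvectorBasis i) u = 0 := by
      linarith
    exact (mul_eq_zero.1 h').resolve_left (sub_ne_zero.2 hi)
  set low := ∑ i, if hA.eigenvalues i = lambdaMin A
    then inner ℝ (hA.eigenvectorBasis i) b ^ 2 else 0 with hlow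
  -- Cauchy–Schwarz inside the `λ_min`-eigenspace, which may have dimension above one.
  have hlowb : inner ℝ u b ^ 2 ≤ low := by
    rw [← hA.eigenvectorBasis.sum_inner_mul_inner u b]
    have h1 : ∑ i, inner ℝ u (hA.eigenvectorBasis i) * inner ℝ (hA.eigenvectorBasis i) b
        = ∑ i, inner ℝ (hA.eigenvectorBasis i) u * (if hA.eigenvalues i = lambdaMin A
          then inner ℝ (hA.eigenvectorBasis i) b else 0) := by
      refine Finset.sum_congr rfl fun i _ => ?_
      rw [real_inner_comm]
      split_ifs with h
      · rfl
      · rw [hui i h]; simp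
    rw [h1]
    refine (Finset.sum_mul_sq_le_sq_mul_sq _ _ _).trans ?_
    rw [← norm_sq_eq_sum_inner hA, hu, one_pow, one_mul, hlow]
    refine Finset.sum_le_sum fun i _ => ?_
    split_ifs <;> simp
  -- The `λ_min` part contributes `-ηD p(0)² low`. The rest adds at most `ηD p(0)² ‖b‖²/R²`, and
  -- `‖b‖²/R² = (uᵀb)² ≤ low`.
  have hform : shiftedForm A (-(lambdaMin A + η * D)) v ≤ 0 := by
    have hterm : ∀ i, (hA.eigenvalues i + -(lambdaMin A + η * D))
        * inner ℝ (hA.eigenvectorBasis i) v ^ 2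
        ≤ η * D * p.eval 0 ^ 2 * (inner ℝ (hA.eigenvectorBasis i) b ^ 2 / R ^ 2
          - if hA.eigenvalues i = lambdaMin A
            then inner ℝ (hA.eigenvectorBasis i) b ^ 2 else 0) := by
      intro i
      rw [hvi, mul_pow]
      split_ifs with h
      · rw [h, sub_self]
        have : 0 ≤ η * D * p.eval 0 ^ 2 * (inner ℝ (hA.eigenvectorBasis i) b ^ 2 / R ^ 2) := by
          positivity
        linarith
      · have h1 := hp (hA.eigenvalues i - lambdaMin A)
          ⟨sub_nonneg.2 (lambdaMin_le_eigenvalues hA i),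
            (sub_le_sub_right (eigenvalues_le_lambdaMax hA i) _).trans hDA⟩
        rw [← le_div_iff₀ (by positivity)] at h1
        have h2 := mul_le_mul_of_nonneg_right h1 (sq_nonneg (inner ℝ (hA.eigenvectorBasis i) b))
        calc _ = (hA.eigenvalues i - lambdaMin A - η * D)
              * p.eval (hA.eigenvalues i - lambdaMin A) ^ 2
              * inner ℝ (hA.eigenvectorBasis i) b ^ 2 := by ring
          _ ≤ _ := h2
          _ = _ := by ring
    rw [shiftedForm_eq_sum hA]
    refine (Finset.sum_le_sum fun i _ => hterm i).trans ?_
    rw [← Finset.mul_sum, Finset.sum_sub_distrib, ← Finset.sum_div, ← norm_sq_eq_sum_inner hA,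
      ← hlow, ← hRsq, mul_div_cancel_left₀ _ (by positivity)]
    exact mul_nonpos_of_nonneg_of_nonpos (by positivity) (by linarith)
  have hvne : v ≠ 0 := by
    intro hv0
    have hnz : low = 0 := by
      rw [hlow]
      refine Finset.sum_eq_zero fun i _ => ?_
      split_ifs with h
      · have h1 := hvi i
        rw [hv0, inner_zero_right, h, sub_self] at h1
        rw [(mul_eq_zero.1 h1.symm).resolve_left hp0]
        simp
      · rfl
    have : 0 < inner ℝ u b ^ 2 := by positivity
    linarith
  have hvn : ‖v‖ ≠ 0 := norm_ne_zero_iff.2 hvne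
  refine ⟨‖v‖⁻¹ • v, Submodule.smul_mem _ _ (aeval_mem_krylov b hdeg), norm_smul_inv_norm hvne, ?_⟩
  have h1 : shiftedForm A (-(lambdaMin A + η * D)) (‖v‖⁻¹ • v) ≤ 0 := by
    rw [shiftedForm_smul]
    exact mul_nonpos_of_nonneg_of_nonpos (by positivity) hform
  rw [shiftedForm, norm_smul, norm_inv, norm_norm, inv_mul_cancel₀ hvn] at h1
  have h2 : η ≤ Real.log (4 * ‖b‖ ^ 2 / inner ℝ u b ^ 2) ^ 2 / (8 * ((t : ℝ) - 1 / 2) ^ 2) := by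
    rw [hlog]
    refine hη.trans (le_of_eq ?_)
    rw [show 8 * ((t : ℝ) - 1 / 2) ^ 2 = 4 * (2 * ((t : ℝ) - 1 / 2) ^ 2) by ring, mul_pow,
      show (2 : ℝ) ^ 2 = 4 by norm_num, mul_div_mul_left _ _ (by norm_num : (4 : ℝ) ≠ 0)]
  have h3 := mul_le_mul_of_nonneg_left h2 hD.le
  linarith

/-- The line through a point `y` of a ball in a unit direction `z` meets the sphere at distance at
most `√(r² - ‖y‖²)` from `y`. -/
lemma exists_norm_add_smul_eq {y z : EuclideanSpace ℝ (Fin d)} {r : ℝ} (hr : 0 ≤ r)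
    (hy : ‖y‖ ^ 2 ≤ r ^ 2) (hz : ‖z‖ = 1) :
    ∃ α : ℝ, α ^ 2 ≤ r ^ 2 - ‖y‖ ^ 2 ∧ ‖y + α • z‖ = r := by
  -- With the sign of `z` chosen so that `β ≥ 0`, the root `σ - β` satisfies `(σ-β)² ≤ σ² - β²`.
  suffices h : ∀ w : EuclideanSpace ℝ (Fin d), ‖w‖ = 1 → 0 ≤ inner ℝ y w →
      ∃ α : ℝ, α ^ 2 ≤ r ^ 2 - ‖y‖ ^ 2 ∧ ‖y + α • w‖ = r by
    rcases le_total 0 (inner ℝ y z) with h0 | h0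
    · exact h z hz h0
    · obtain ⟨α, h1, h2⟩ := h (-z) (by rwa [norm_neg]) (by rw [inner_neg_right]; linarith)
      exact ⟨-α, by rwa [neg_sq], by rwa [neg_smul, ← smul_neg]⟩
  intro w hw hyw
  set β := inner ℝ y w with hβ
  have hrad : 0 ≤ β ^ 2 + (r ^ 2 - ‖y‖ ^ 2) := by nlinarith
  have hsq := Real.sq_sqrt hrad
  have hge : β ≤ Real.sqrt (β ^ 2 + (r ^ 2 - ‖y‖ ^ 2)) := Real.le_sqrt_of_sq_le (by linarith)
  set σ := Real.sqrt (β ^ 2 + (r ^ 2 - ‖y‖ ^ 2)) with hσ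
  refine ⟨σ - β, by nlinarith, ?_⟩
  refine (sq_eq_sq₀ (norm_nonneg _) hr).1 ?_
  rw [norm_add_sq_real, real_inner_smul_right, norm_smul, hw, mul_one, Real.norm_eq_abs, sq_abs,
    ← hβ]
  nlinarith

lemma sublinear_rate_of_lt (hA : A.IsHermitian) {b : EuclideanSpace ℝ (Fin d)} {ρ : ℝ} (hρ : 0 ≤ ρ)
    {s : EuclideanSpace ℝ (Fin d)} (hs : IsMinimizer (cubic A b ρ) Set.univ s)
    {t : ℕ} (ht : 0 < t) {st : EuclideanSpace ℝ (Fin d)}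
    (hst : IsMinimizer (cubic A b ρ) (krylov A b t) st)
    {u : EuclideanSpace ℝ (Fin d)} (hu : ‖u‖ = 1)
    (hAu : Matrix.toEuclideanLin A u = lambdaMin A • u)
    (hub : lambdaMin A < 0 → inner ℝ u b ≠ 0) {D : ℝ} (hDA : lambdaMax A - lambdaMin A < D) :
    cubic A b ρ st - cubic A b ρ s ≤ D * ‖s‖ ^ 2 / ((t : ℝ) - 1 / 2) ^ 2 *
      (4 + (if lambdaMin A < 0 then 1 else 0) / 8 *
        Real.log (4 * ‖b‖ ^ 2 / inner ℝ u b ^ 2) ^ 2) := by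
  set μ := ρ * ‖s‖ with hμdef
  set θ := lambdaMin A + μ with hθdef
  have hstat := stationary_of_isMinimizer hA hρ hs
  have hθ : 0 ≤ θ := lambdaMin_add_nonneg hA hρ hs
  have hD : 0 < D := (sub_nonneg.2 (lambdaMin_le_lambdaMax A hA)).trans_lt hDA
  obtain ⟨q, δ, hq, hq0, hδ1, hδ, hqb⟩ := exists_poly_sublinear_rate ht hθ hD
  replace hqb := fun i => hqb (hA.eigenvalues i + μ)
    ⟨by linarith [lambdaMin_le_eigenvalues hA i], by linarith [eigenvalues_le_lambdaMax hA i]⟩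
  obtain ⟨y, hyK, hy⟩ := exists_mem_krylov_of_poly hA hstat ht hq hq0
  set qi : Fin d → ℝ := fun i => q.eval (hA.eigenvalues i + μ) with hqi
  set si : Fin d → ℝ := fun i => inner ℝ (hA.eigenvectorBasis i) s with hsi
  have hysi : ∀ i, inner ℝ (hA.eigenvectorBasis i) (y - s) = -qi i * si i := by
    intro i
    rw [inner_sub_right, hy]; ring
  have hns : ‖s‖ ^ 2 = ∑ i, si i ^ 2 := norm_sq_eq_sum_inner hA s
  have hdist : ‖y - s‖ ^ 2 = ∑ i, qi i ^ 2 * si i ^ 2 := by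
    rw [norm_sq_eq_sum_inner hA]
    exact Finset.sum_congr rfl fun i _ => by rw [hysi]; ring
  -- The term `-‖y-s‖²` later cancels the `θ‖y-s‖²` in the energy bound, leaving the `2θδ +
  -- D/(t+1)²` controlled by `hδ`.
  have hny : ‖s‖ ^ 2 - ‖y‖ ^ 2 = 2 * ∑ i, qi i * si i ^ 2 - ‖y - s‖ ^ 2 := by
    rw [hdist, hns, norm_sq_eq_sum_inner hA y, Finset.mul_sum, ← Finset.sum_sub_distrib,
      ← Finset.sum_sub_distrib]
    exact Finset.sum_congr rfl fun i _ => by rw [hy]; ring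
  have hqs : ∑ i, qi i * si i ^ 2 ≤ δ * ‖s‖ ^ 2 := by
    rw [hns, Finset.mul_sum]
    exact Finset.sum_le_sum fun i _ => mul_le_mul_of_nonneg_right (hqb i).2.1 (sq_nonneg _)
  have hdistq : ‖y - s‖ ^ 2 ≤ ∑ i, qi i * si i ^ 2 := by
    rw [hdist]
    refine Finset.sum_le_sum fun i _ => mul_le_mul_of_nonneg_right ?_ (sq_nonneg _)
    have h1 := (hqb i).1
    have h2 := (hqb i).2.1.trans hδ1
    rw [sq]
    exact mul_le_of_le_one_left h1 h2
  have henergy : shiftedForm A μ (y - s) ≤ D / ((t : ℝ) + 1) ^ 2 * ‖s‖ ^ 2 + θ * ‖y - s‖ ^ 2 := by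
    rw [shiftedForm_eq_sum hA, hdist, hns, Finset.mul_sum, Finset.mul_sum,
      ← Finset.sum_add_distrib]
    refine Finset.sum_le_sum fun i _ => ?_
    rw [hysi]
    have h := mul_le_mul_of_nonneg_right (hqb i).2.2 (sq_nonneg (si i))
    linarith
  have hyle : ‖y‖ ^ 2 ≤ ‖s‖ ^ 2 := by linarith [sq_nonneg ‖y - s‖]
  have hbudget := mul_le_mul_of_nonneg_right hδ (sq_nonneg ‖s‖)
  have hqθ := mul_le_mul_of_nonneg_left hqs hθ
  have hdθ := mul_le_mul_of_nonneg_left hdistq hθ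
  have hDs : 0 ≤ D / ((t : ℝ) + 1) ^ 2 * ‖s‖ ^ 2 := by positivity
  split_ifs with hneg
  · obtain ⟨z, hzK, hz1, hz⟩ := exists_mem_krylov_ritz hA hu hAu (hub hneg) ht hD hDA.le
    set ℓ := Real.log (4 * ‖b‖ ^ 2 / inner ℝ u b ^ 2) ^ 2 / (8 * ((t : ℝ) - 1 / 2) ^ 2) with hℓ
    have hℓ0 : 0 ≤ ℓ := by positivity
    obtain ⟨α, hα, hαn⟩ := exists_norm_add_smul_eq (norm_nonneg s) hyle hz1
    have hx := hst.2 (y + α • z) (Submodule.add_mem _ hyK (Submodule.smul_mem _ _ hzK))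
    have hgap : cubic A b ρ (y + α • z) - cubic A b ρ s
        = 1 / 2 * shiftedForm A μ (y - s + α • z) := by
      rw [cubic_sub_cubic hA hstat, hαn, show y + α • z - s = y - s + α • z by abel]
      ring
    -- Parallelogram inequality for the positive semidefinite form `A + μ`.
    have hpar : shiftedForm A μ (y - s + α • z)
        ≤ 2 * shiftedForm A μ (y - s) + 2 * (α ^ 2 * shiftedForm A μ z) := by
      have h1 := shiftedForm_nonneg_of_isMinimizer hA hρ hs (y - s + (-1 : ℝ) • α • z)
      rw [shiftedForm_add hA, shiftedForm_smul, map_smul, real_inner_smul_right,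
        real_inner_smul_right] at h1
      rw [← shiftedForm_smul, shiftedForm_add hA]
      linarith
    have hzform : shiftedForm A μ z ≤ θ + D * ℓ := by
      rw [shiftedForm, hz1]; linarith
    have hαz : α ^ 2 * shiftedForm A μ z ≤ (‖s‖ ^ 2 - ‖y‖ ^ 2) * θ + ‖s‖ ^ 2 * (D * ℓ) := by
      calc α ^ 2 * shiftedForm A μ z ≤ α ^ 2 * (θ + D * ℓ) := by gcongr
        _ ≤ (‖s‖ ^ 2 - ‖y‖ ^ 2) * (θ + D * ℓ) := by gcongr
        _ ≤ _ := by nlinarith [mul_nonneg (sq_nonneg ‖y‖) (mul_nonneg hD.le hℓ0)]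
    rw [hny] at hαz
    have hrhs : D * ‖s‖ ^ 2 / ((t : ℝ) - 1 / 2) ^ 2 * (4 + 1 / 8 *
        Real.log (4 * ‖b‖ ^ 2 / inner ℝ u b ^ 2) ^ 2)
        = 4 * D / ((t : ℝ) - 1 / 2) ^ 2 * ‖s‖ ^ 2 + ‖s‖ ^ 2 * (D * ℓ) := by
      rw [hℓ, mul_comm (8 : ℝ), ← div_div]
      ring
    rw [hrhs]
    linarith
  · have hx := hst.2 y hyK
    have hgap := cubic_sub_cubic hA hstat y
    have hyle' : ‖y‖ ≤ ‖s‖ := le_of_sq_le_sq hyle (norm_nonneg s)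
    have hsq : (‖s‖ - ‖y‖) ^ 2 ≤ ‖y - s‖ ^ 2 := by
      rw [← sq_abs, norm_sub_rev y s]
      exact pow_le_pow_left₀ (abs_nonneg _) (abs_norm_sub_norm_le s y) 2
    have hcub : ρ / 6 * ((‖s‖ - ‖y‖) ^ 2 * (2 * ‖y‖ + ‖s‖)) ≤ 1 / 2 * (θ * ‖y - s‖ ^ 2) := by
      calc ρ / 6 * ((‖s‖ - ‖y‖) ^ 2 * (2 * ‖y‖ + ‖s‖))
          ≤ ρ / 6 * (‖y - s‖ ^ 2 * (2 * ‖s‖ + ‖s‖)) := by gcongr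
        _ = 1 / 2 * (μ * ‖y - s‖ ^ 2) := by rw [hμdef]; ring
        _ ≤ _ := by
          gcongr
          linarith
    have hrhs : D * ‖s‖ ^ 2 / ((t : ℝ) - 1 / 2) ^ 2 * (4 + 0 / 8 *
        Real.log (4 * ‖b‖ ^ 2 / inner ℝ u b ^ 2) ^ 2)
        = 4 * D / ((t : ℝ) - 1 / 2) ^ 2 * ‖s‖ ^ 2 := by ring
    rw [hrhs]
    have hθq : 0 ≤ θ * ‖y - s‖ ^ 2 := by positivity
    linarith

/-- The width `D` was taken strictly larger than the spectral width so that division by `D` is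
legitimate even when `A` is scalar; letting `D` decrease to the width gives the bound. -/
theorem sublinear_rate (hA : A.IsHermitian) {b : EuclideanSpace ℝ (Fin d)} {ρ : ℝ} (hρ : 0 ≤ ρ)
    {s : EuclideanSpace ℝ (Fin d)} (hs : IsMinimizer (cubic A b ρ) Set.univ s)
    {t : ℕ} (ht : 0 < t) {st : EuclideanSpace ℝ (Fin d)}
    (hst : IsMinimizer (cubic A b ρ) (krylov A b t) st)
    {u : EuclideanSpace ℝ (Fin d)} (hu : ‖u‖ = 1)
    (hAu : Matrix.toEuclideanLin A u = lambdaMin A • u)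
    (hub : lambdaMin A < 0 → inner ℝ u b ≠ 0) :
    cubic A b ρ st - cubic A b ρ s ≤
      (lambdaMax A - lambdaMin A) * ‖s‖ ^ 2 / ((t : ℝ) - 1 / 2) ^ 2 *
      (4 + (if lambdaMin A < 0 then 1 else 0) / 8 *
        Real.log (4 * ‖b‖ ^ 2 / inner ℝ u b ^ 2) ^ 2) := by
  refine ge_of_tendsto (x := nhdsWithin (lambdaMax A - lambdaMin A)
    (Set.Ioi (lambdaMax A - lambdaMin A))) (f := fun D => D * ‖s‖ ^ 2 / ((t : ℝ) - 1 / 2) ^ 2 *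
      (4 + (if lambdaMin A < 0 then 1 else 0) / 8 *
        Real.log (4 * ‖b‖ ^ 2 / inner ℝ u b ^ 2) ^ 2)) ?_ ?_
  · refine tendsto_nhdsWithin_of_tendsto_nhds (Continuous.tendsto ?_ _)
    fun_prop
  · filter_upwards [self_mem_nhdsWithin] with D hDA
    exact sublinear_rate_of_lt hA hρ hs ht hst hu hAu hub hDA

theorem cubic_gap_le_trust_region_gap {b : EuclideanSpace ℝ (Fin d)} {ρ : ℝ} (hρ : 0 ≤ ρ)
    {s : EuclideanSpace ℝ (Fin d)} {t : ℕ} {st r rt : EuclideanSpace ℝ (Fin d)}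
    (hst : IsMinimizer (cubic A b ρ) (krylov A b t) st)
    (hr : IsMinimizer (quad A b) {x | ‖x‖ ≤ ‖s‖} r)
    (hrt : IsMinimizer (quad A b) {x | x ∈ krylov A b t ∧ ‖x‖ ≤ ‖s‖} rt) :
    cubic A b ρ st - cubic A b ρ s ≤ quad A b rt - quad A b r := by
  have h1 := hst.2 rt hrt.1.1
  have h2 := hr.2 s (le_refl ‖s‖)
  have h3 : ρ / 3 * ‖rt‖ ^ 3 ≤ ρ / 3 * ‖s‖ ^ 3 := by
    have := hrt.1.2
    gcongr
  have h4 : cubic A b ρ rt = quad A b rt + ρ / 3 * ‖rt‖ ^ 3 := rfl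
  have h5 : cubic A b ρ s = quad A b s + ρ / 3 * ‖s‖ ^ 3 := rfl
  linarith

end Rates

end KrylovCubic

theorem corollary3 {d : ℕ} (A : Matrix (Fin d) (Fin d) ℝ) (hA : A.IsSymm)
    (b : EuclideanSpace ℝ (Fin d)) (ρ : ℝ) (hρ : 0 ≤ ρ)
    (s : EuclideanSpace ℝ (Fin d))
    (hs : KrylovCubic.IsMinimizer (KrylovCubic.cubic A b ρ) Set.univ s)
    (t : ℕ) (ht : 0 < t) (st : EuclideanSpace ℝ (Fin d))
    (hst : KrylovCubic.IsMinimizer (KrylovCubic.cubic A b ρ) (KrylovCubic.krylov A b t) st) :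
    -- linear rate
    (KrylovCubic.cubic A b ρ st - KrylovCubic.cubic A b ρ s ≤
      36 * (KrylovCubic.cubic A b ρ 0 - KrylovCubic.cubic A b ρ s) *
        Real.exp (-4 * (t : ℝ) *
          Real.sqrt ((KrylovCubic.lambdaMin A + ρ * ‖s‖) /
            (KrylovCubic.lambdaMax A + ρ * ‖s‖)))) ∧
    -- sublinear rate; for `λ_min < 0` and `uᵀ b = 0` the right-hand side is infinite
    (∀ u : EuclideanSpace ℝ (Fin d), ‖u‖ = 1 →
      Matrix.toEuclideanLin A u = KrylovCubic.lambdaMin A • u →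
      (KrylovCubic.lambdaMin A < 0 → inner ℝ u b ≠ 0) →
      KrylovCubic.cubic A b ρ st - KrylovCubic.cubic A b ρ s ≤
        (KrylovCubic.lambdaMax A - KrylovCubic.lambdaMin A) * ‖s‖ ^ 2 / ((t : ℝ) - 1 / 2) ^ 2 *
          (4 + (if KrylovCubic.lambdaMin A < 0 then 1 else 0) / 8 *
            Real.log (4 * ‖b‖ ^ 2 / inner ℝ u b ^ 2) ^ 2)) ∧
    -- the gap is at most that of the trust-region instance with radius `‖s‖`
    (∀ r rt : EuclideanSpace ℝ (Fin d),
      KrylovCubic.IsMinimizer (KrylovCubic.quad A b) {x | ‖x‖ ≤ ‖s‖} r →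
      KrylovCubic.IsMinimizer (KrylovCubic.quad A b)
        {x | x ∈ KrylovCubic.krylov A b t ∧ ‖x‖ ≤ ‖s‖} rt →
      KrylovCubic.cubic A b ρ st - KrylovCubic.cubic A b ρ s ≤
        KrylovCubic.quad A b rt - KrylovCubic.quad A b r) := by
  have hH : A.IsHermitian := by
    rw [Matrix.IsHermitian, Matrix.conjTranspose_eq_transpose_of_trivial]
    exact hA
  exact ⟨KrylovCubic.linear_rate hH hρ hs ht hst,
    fun _ hu hAu hub => KrylovCubic.sublinear_rate hH hρ hs ht hst hu hAu hub,
    fun _ _ hr hrt => KrylovCubic.cubic_gap_le_trust_region_gap hρ hst hr hrt⟩
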